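/- Let $N \ge 2$ be an integer, let $p>2$, and let $F:\mathbb{R}^2\to\mathbb{R}$ be of class $C^2$, positively homogeneous of degree $p$ (that is, $F(su,sv)=s^pF(u,v)$ for $s>0$), with $F(u,v)>0$ for $(u,v)\neq(0,0)$; write $D^2F$ for its Hessian matrix. Let $\lambda,\mu_1,\mu_2\ge 0$ be constants and let $\beta_k,\gamma_k>0$, $k\in\mathbb{N}$, satisfy $\lim_{k\to\infty}\beta_k=\lim_{k\to\infty}\gamma_k=0$. For every $k\in\mathbb{N}$ let $(u_k,v_k)\in C^2([0,\infty),\mathbb{R}^2)$ be a bounded solution (with a bound that may depend on $k$) of the system $$ \begin{aligned} -\bigl(e^{-\gamma_k t}u_k'\bigr)'+\beta_k^2e^{-\beta_kNt}\mu_1u_k&=e^{-Nt}\,\partial_uF(u_k,v_k)&&\text{in }(0,\infty),\\ -\bigl(e^{-\gamma_k t}v_k'\bigr)'+\beta_k^2e^{-\beta_kNt}\mu_2v_k&=e^{-Nt}\,\partial_vF(u_k,v_k)&&\text{in }(0,\infty),\\ u_k(0)=v_k(0)&=0. \end{aligned} $$ Assume that for every $k\in\mathbb{N}$ and every $\varphi\in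 C^1_c((0,\infty),\mathbb{R}^2)$, $$ Q_k(\varphi):=\int_0^\infty\Bigl(e^{-\gamma_kt}|\varphi'(t)|^2+\lambda\beta_k^2e^{-\gamma_kt}|\varphi(t)|^2-\bigl\langle U_k(t)\varphi(t),\varphi(t)\bigr\rangle\Bigr)\,dt\ \ge\ 0, $$ where $$ U_k(t):=e^{-Nt}D^2F(u_k(t),v_k(t))-\beta_k^2e^{-\beta_kNt}\begin{pmatrix}\mu_1&0\\0&\mu_2\end{pmatrix}. $$ Then there is $k_0\in\mathbb{N}$ such that $u_k\equiv v_k\equiv0$ on $[0,\infty)$ for all $k\ge k_0$. -/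

import Mathlib

open Filter Topology Set MeasureTheory

namespace HenonSystem

noncomputable section

/-- The partial derivative `∂_u F` of a function `F(u, v)` of two real variables. -/
def partialU (F : ℝ × ℝ → ℝ) (z : ℝ × ℝ) : ℝ := fderiv ℝ F z (1, 0)

/-- The partial derivative `∂_v F` of a function `F(u, v)` of two real variables. -/
def partialV (F : ℝ × ℝ → ℝ) (z : ℝ × ℝ) : ℝ := fderiv ℝ F z (0, 1)

/-- The Hessian matrix `D² F(u, v)`. -/
def hessian (F : ℝ × ℝ → ℝ) (z : ℝ × ℝ) : Matrix (Fin 2) (Fin 2) ℝ :=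
  !![partialU (partialU F) z, partialV (partialU F) z;
     partialV (partialU F) z, partialV (partialV F) z]

/-- Assumption (F): `F` is of class `C²` on `ℝ²`, (positively) homogeneous of degree `p`, and
positive away from the origin. -/
structure AssumptionF (F : ℝ × ℝ → ℝ) (p : ℝ) : Prop where
  contDiff : ContDiff ℝ 2 F
  homogeneous : ∀ (s : ℝ) (z : ℝ × ℝ), 0 < s → F (s • z) = s ^ p * F z
  pos : ∀ z : ℝ × ℝ, z ≠ 0 → 0 < F z

/-- `(u, v) ∈ C²([0, ∞), ℝ²)` is a bounded solution of
`-(e^{-γt} u')' + β² e^{-βNt} μ₁ u = e^{-Nt} ∂_u F(u, v)`,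
`-(e^{-γt} v')' + β² e^{-βNt} μ₂ v = e^{-Nt} ∂_v F(u, v)` in `(0, ∞)`, `u(0) = v(0) = 0`.
Only the values of `u` and `v` on `[0, ∞)` matter. -/
structure IsBoundedSolution (N : ℕ) (F : ℝ × ℝ → ℝ) (μ₁ μ₂ β γ : ℝ) (u v : ℝ → ℝ) : Prop where
  contDiffOn_u : ContDiffOn ℝ 2 u (Ici 0)
  contDiffOn_v : ContDiffOn ℝ 2 v (Ici 0)
  bounded : ∃ C : ℝ, ∀ t : ℝ, 0 ≤ t → |u t| ≤ C ∧ |v t| ≤ C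
  eq_u : ∀ t : ℝ, 0 < t →
    -deriv (fun s => Real.exp (-γ * s) * deriv u s) t
      + β ^ 2 * Real.exp (-β * N * t) * μ₁ * u t = Real.exp (-N * t) * partialU F (u t, v t)
  eq_v : ∀ t : ℝ, 0 < t →
    -deriv (fun s => Real.exp (-γ * s) * deriv v s) t
      + β ^ 2 * Real.exp (-β * N * t) * μ₂ * v t = Real.exp (-N * t) * partialV F (u t, v t)
  zero_u : u 0 = 0
  zero_v : v 0 = 0

/-- The potential `U(t) = e^{-Nt} D² F(u(t), v(t)) - β² e^{-βNt} diag(μ₁, μ₂)`. -/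
def potential (N : ℕ) (F : ℝ × ℝ → ℝ) (μ₁ μ₂ β : ℝ) (u v : ℝ → ℝ) (t : ℝ) :
    Matrix (Fin 2) (Fin 2) ℝ :=
  Real.exp (-N * t) • hessian F (u t, v t)
    - (β ^ 2 * Real.exp (-β * N * t)) • !![μ₁, 0; 0, μ₂]

/-- The space `C¹_c((0, ∞), ℝ²)`, its members being extended by zero to `ℝ`. -/
def IsTestFunction (φ : ℝ → EuclideanSpace ℝ (Fin 2)) : Prop :=
  ContDiff ℝ 1 φ ∧ HasCompactSupport φ ∧ tsupport φ ⊆ Ioi 0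

/-- The quadratic form
`Q(φ) = ∫₀^∞ (e^{-γt} |φ'|² + lam β² e^{-γt} |φ|² - ⟨U(t) φ, φ⟩) dt`. -/
def quadForm (N : ℕ) (F : ℝ × ℝ → ℝ) (lam μ₁ μ₂ β γ : ℝ) (u v : ℝ → ℝ)
    (φ : ℝ → EuclideanSpace ℝ (Fin 2)) : ℝ :=
  ∫ t in Ioi (0 : ℝ),
    (Real.exp (-γ * t) * ‖deriv φ t‖ ^ 2 + lam * β ^ 2 * Real.exp (-γ * t) * ‖φ t‖ ^ 2
      - inner ℝ (Matrix.toEuclideanLin (potential N F μ₁ μ₂ β u v t) (φ t)) (φ t))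

end

end HenonSystem

/-! Fix `k`, write `z = (u, v)`, `ε = β + γ`, `a = N - γ`, and let `M` be the supremum of `|z|` in
the maximum norm. If `z ≢ 0` and `ε ≤ 1`, then `ε` is bounded below by a positive constant
independent of `k` and of `M`; as `ε → 0` along the sequence, only the zero solution survives. No
bound on `M` uniform in `k` is needed, because both sides of the decisive inequality scale like
`M²`.

Stability is tested with `φ = η z`. The system and Euler's identities for `F` and its gradient
reduce it to `p(p-2) ∫ η² e^{-Nt} F(z) ≤ ∫ e^{-γt} (η'² + λβ²η²) |z|²` (`integral_potential_le`),
where `p > 2` makes the left side useful. Take `η = e^{γt/2} θ` with `θ` a cutoff at scale `1/ε`: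
the right integrand is of order `ε² M²` on a length `4/ε`, so the right side is `O(ε M²)`
(`integral_cutoff_le`).

For the left side, `|∇F(z)| ≤ C M^{p-1}` and a maximum principle show that `|z|` grows from `s` to
`t` by at most `E (e^{-as} - e^{-at})` with `E` of order `M^{p-1}` (`norm_le_norm_add`). Starting
from `z(0) = 0`, reaching `M/2` uses up weight `∫ e^{-at}` of order at least `M/E`, on a set where
`F(z) ≥ c M^p` (`exists_interval_of_increment`). The left side is therefore at least `c M^p · M/E`,
that is `c M²`, and `M²` cancels. -/

namespace HenonSystem

/-! ### Maximum principle and growth of bounded solutions -/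

/-- If `y` is bounded above on `[s, ∞)`, `y(s) ≤ 0`, and `g = e^{-γt} y'` is nondecreasing
wherever `y > 0`, then `y ≤ 0`. -/
theorem nonpos_of_flux_monotone {y g g' : ℝ → ℝ} {s γ C : ℝ} (hs : 0 ≤ s) (hγ : 0 ≤ γ)
    (hc : ContinuousOn y (Ici s)) (hy : ∀ t, s < t → HasDerivAt y (Real.exp (γ * t) * g t) t)
    (hg : ∀ t, s < t → HasDerivAt g (g' t) t) (hpos : ∀ t, s < t → 0 < y t → 0 ≤ g' t)
    (hC : ∀ t, s ≤ t → y t ≤ C) (hys : y s ≤ 0) : ∀ t, s ≤ t → y t ≤ 0 := by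
  intro t₁ ht₁
  by_contra! h₁
  have mono : ∀ a b, s < a → (∀ t ∈ Ioo a b, 0 < y t) → MonotoneOn g (Icc a b) := by
    intro a b ha hab
    refine monotoneOn_of_hasDerivWithinAt_nonneg (f' := g') (convex_Icc a b)
      (fun t ht => (hg t (ha.trans_le ht.1)).continuousAt.continuousWithinAt) ?_ ?_
    · intro t ht
      rw [interior_Icc] at ht
      exact (hg t (ha.trans ht.1)).hasDerivWithinAt
    · intro t ht
      rw [interior_Icc] at ht
      exact hpos t (ha.trans ht.1) (hab t ht)
  obtain ⟨a, haS, hya, hab⟩ : ∃ a ∈ Icc s t₁, y a ≤ 0 ∧ ∀ t ∈ Ioc a t₁, 0 < y t := by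
    have hcl : IsClosed (Icc s t₁ ∩ y ⁻¹' Iic 0) :=
      (hc.mono Icc_subset_Ici_self).preimage_isClosed_of_isClosed isClosed_Icc isClosed_Iic
    have hne : (Icc s t₁ ∩ y ⁻¹' Iic 0).Nonempty := ⟨s, ⟨le_rfl, ht₁⟩, hys⟩
    have hbd : BddAbove (Icc s t₁ ∩ y ⁻¹' Iic 0) := ⟨t₁, fun x hx => hx.1.2⟩
    have hm := hcl.csSup_mem hne hbd
    refine ⟨_, hm.1, hm.2, fun t ht => ?_⟩
    by_contra! h
    exact absurd (le_csSup hbd ⟨⟨hm.1.1.trans ht.1.le, ht.2⟩, h⟩) (not_le.2 ht.1)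
  have hat : a < t₁ := lt_of_le_of_ne haS.2 (by rintro rfl; linarith)
  -- `y` rises from a nonpositive value at `a` to a positive one at `t₁`, so the flux is positive
  -- somewhere in between.
  obtain ⟨t₂, ht₂, hd⟩ := exists_hasDerivAt_eq_slope y (fun t => Real.exp (γ * t) * g t) hat
    (hc.mono fun x hx => haS.1.trans hx.1) (fun x hx => hy x (haS.1.trans_lt hx.1))
  have hst₂ : s < t₂ := haS.1.trans_lt ht₂.1
  have hy₂ : 0 < y t₂ := hab t₂ ⟨ht₂.1, ht₂.2.le⟩
  have hg₂ : 0 < g t₂ := by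
    have : 0 < Real.exp (γ * t₂) * g t₂ := by
      rw [hd]; exact div_pos (by linarith) (by linarith)
    exact (pos_iff_pos_of_mul_pos this).1 (Real.exp_pos _)
  -- While `y > 0` the flux stays at least `g t₂`, and `e^{γt} ≥ 1` turns this into `y' ≥ g t₂`:
  -- growth is at least linear, which contradicts boundedness.
  have grow : ∀ b, t₂ ≤ b → (∀ t ∈ Ioo t₂ b, 0 < y t) → y t₂ + g t₂ * (b - t₂) ≤ y b := by
    intro b hb hpb
    have hm := mono t₂ b hst₂ hpb
    have := (convex_Icc t₂ b).mul_sub_le_image_sub_of_le_deriv (f := y) (C := g t₂)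
      (hc.mono fun x hx => hst₂.le.trans hx.1)
      (fun t ht => by
        rw [interior_Icc] at ht
        exact (hy t (hst₂.trans ht.1)).differentiableAt.differentiableWithinAt)
      (fun t ht => by
        rw [interior_Icc] at ht
        rw [(hy t (hst₂.trans ht.1)).deriv]
        have h1 : g t₂ ≤ g t := hm ⟨le_rfl, hb⟩ ⟨ht.1.le, ht.2.le⟩ ht.1.le
        have h2 : 1 ≤ Real.exp (γ * t) :=
          Real.one_le_exp (mul_nonneg hγ (hs.trans (hst₂.trans ht.1).le))
        nlinarith) t₂ ⟨le_rfl, hb⟩ b ⟨hb, le_rfl⟩ hb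
    linarith
  have hall : ∀ t, t₂ ≤ t → 0 < y t := by
    intro t ht
    by_contra! h
    have hcl : IsClosed (Icc t₂ t ∩ y ⁻¹' Iic 0) :=
      (hc.mono fun x hx => hst₂.le.trans hx.1).preimage_isClosed_of_isClosed
        isClosed_Icc isClosed_Iic
    have hbd : BddBelow (Icc t₂ t ∩ y ⁻¹' Iic 0) := ⟨t₂, fun x hx => hx.1.1⟩
    have hm := hcl.csInf_mem ⟨t, ⟨ht, le_rfl⟩, h⟩ hbd
    set b := sInf (Icc t₂ t ∩ y ⁻¹' Iic 0)
    have := grow b hm.1.1 (fun x hx => by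
      by_contra! hx0
      exact absurd (csInf_le hbd ⟨⟨hx.1.le, hx.2.le.trans hm.1.2⟩, hx0⟩) (not_le.2 hx.2))
    have h3 : y b ≤ 0 := hm.2
    have h4 : 0 ≤ g t₂ * (b - t₂) := mul_nonneg hg₂.le (by linarith [hm.1.1])
    linarith
  have hC₂ : 0 < C := hy₂.trans_le (hC _ hst₂.le)
  have := grow (t₂ + C / g t₂) (by have := div_pos hC₂ hg₂; linarith)
    (fun t ht => hall t ht.1.le)
  have h5 := hC (t₂ + C / g t₂) (by have := div_pos hC₂ hg₂; linarith)
  have h6 : g t₂ * (t₂ + C / g t₂ - t₂) = C := by field_simp; ring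
  linarith

/-- The subtracted exponential term `w` is a barrier: `-(e^{-γt} w')' = D e^{-nt} ≥ f`. Where `u -
|u s| - w > 0` one has `u ≥ 0`, so `q u` has the favourable sign and the flux of the difference is
nondecreasing. -/
theorem le_abs_add_of_flux_le {u q f : ℝ → ℝ} {n γ C D s t : ℝ} (hu : ContDiffOn ℝ 2 u (Ici 0))
    (hC : ∀ t, 0 ≤ t → |u t| ≤ C)
    (heq : ∀ t, 0 < t → -deriv (fun s => Real.exp (-γ * s) * deriv u s) t + q t * u t = f t)
    (hq : ∀ t, 0 < t → 0 ≤ q t) (hf : ∀ t, 0 < t → f t ≤ D * Real.exp (-n * t))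
    (hD : 0 ≤ D) (hγ : 0 ≤ γ) (hn : 0 < n) (hγn : γ < n) (hs : 0 ≤ s) (hst : s ≤ t) :
    u t ≤ |u s| + D / (n * (n - γ)) * (Real.exp (-(n - γ) * s) - Real.exp (-(n - γ) * t)) := by
  set K := D / (n * (n - γ)) with hK
  have hK0 : 0 ≤ K := div_nonneg hD (mul_nonneg hn.le (by linarith))
  have hu2 : ContDiffOn ℝ 2 u (Ioi 0) := hu.mono Ioi_subset_Ici_self
  have hud : ∀ t, 0 < t → HasDerivAt u (deriv u t) t := fun t ht =>
    ((hu2.differentiableOn (by norm_num)).differentiableAt (Ioi_mem_nhds ht)).hasDerivAt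
  have hud2 : ∀ t, 0 < t → DifferentiableAt ℝ (deriv u) t := fun t ht =>
    (((hu2.deriv_of_isOpen (m := 1) isOpen_Ioi (by norm_num)).differentiableOn
      (by norm_num)).differentiableAt (Ioi_mem_nhds ht))
  have hexp : ∀ c t : ℝ, HasDerivAt (fun s => Real.exp (c * s)) (Real.exp (c * t) * c) t := by
    intro c t
    simpa using ((hasDerivAt_id t).const_mul c).exp
  have hflux : ∀ t, 0 < t → HasDerivAt (fun s => Real.exp (-γ * s) * deriv u s)
      (q t * u t - f t) t := by
    intro t ht
    have h1 := ((hexp (-γ) t).differentiableAt.mul (hud2 t ht)).hasDerivAt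
    have h2 := heq t ht
    have h3 : deriv (fun s => Real.exp (-γ * s) * deriv u s) t = q t * u t - f t := by linarith
    exact h1.congr_deriv h3
  have key := nonpos_of_flux_monotone
    (y := fun t => u t - |u s| - K * (Real.exp (-(n - γ) * s) - Real.exp (-(n - γ) * t)))
    (g := fun t => Real.exp (-γ * t) * deriv u t - D / n * Real.exp (-n * t))
    (g' := fun t => q t * u t - f t - D / n * (Real.exp (-n * t) * -n)) (s := s) (γ := γ)
    (C := C) hs hγ
    (((hu.continuousOn.mono (Ici_subset_Ici.2 hs)).sub continuousOn_const).sub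
      (by fun_prop)) ?_ ?_ ?_ ?_ ?_ t hst
  · linarith
  · intro t ht
    have h0 : 0 < t := hs.trans_lt ht
    have := ((hud t h0).sub_const (|u s|)).sub
      (((hexp (-(n - γ)) t).const_sub (Real.exp (-(n - γ) * s))).const_mul K)
    refine this.congr_deriv ?_
    have e1 : Real.exp (γ * t) * Real.exp (-γ * t) = 1 := by
      rw [← Real.exp_add]; simp
    have e2 : Real.exp (γ * t) * Real.exp (-n * t) = Real.exp (-(n - γ) * t) := by
      rw [← Real.exp_add]; congr 1; ring
    have e3 : K * (n - γ) = D / n := by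
      have : n - γ ≠ 0 := by linarith
      rw [hK]; field_simp
    calc _ = 1 * deriv u t - K * (n - γ) * Real.exp (-(n - γ) * t) := by ring
      _ = (Real.exp (γ * t) * Real.exp (-γ * t)) * deriv u t
          - D / n * (Real.exp (γ * t) * Real.exp (-n * t)) := by rw [e1, e2, ← e3]
      _ = _ := by ring
  · intro t ht
    exact (hflux t (hs.trans_lt ht)).sub ((hexp (-n) t).const_mul _)
  · intro t ht hy
    have h0 : 0 < t := hs.trans_lt ht
    have hm : Real.exp (-(n - γ) * t) ≤ Real.exp (-(n - γ) * s) :=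
      Real.exp_le_exp.2 (by nlinarith)
    have hut : 0 ≤ u t := by
      have := mul_nonneg hK0 (sub_nonneg.2 hm)
      have := abs_nonneg (u s)
      linarith
    have h1 := mul_nonneg (hq t h0) hut
    have h2 := hf t h0
    have h3 : D / n * (Real.exp (-n * t) * -n) = -(D * Real.exp (-n * t)) := by field_simp
    rw [h3]; linarith
  · intro t ht
    have hm : Real.exp (-(n - γ) * t) ≤ Real.exp (-(n - γ) * s) :=
      Real.exp_le_exp.2 (by nlinarith)
    have := mul_nonneg hK0 (sub_nonneg.2 hm)
    have := abs_nonneg (u s)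
    have := le_abs_self (u t)
    have := hC t (hs.trans ht)
    linarith
  · have := le_abs_self (u s)
    simp only [sub_self, mul_zero, sub_zero]
    linarith

/-- Increments of `|u|` for a bounded solution of `-(e^{-γt} u')' + q u = f` with `q ≥ 0` and
`|f| ≤ D e^{-nt}`. -/
theorem abs_le_abs_add_of_flux {u q f : ℝ → ℝ} {n γ C D s t : ℝ} (hu : ContDiffOn ℝ 2 u (Ici 0))
    (hC : ∀ t, 0 ≤ t → |u t| ≤ C)
    (heq : ∀ t, 0 < t → -deriv (fun s => Real.exp (-γ * s) * deriv u s) t + q t * u t = f t)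
    (hq : ∀ t, 0 < t → 0 ≤ q t) (hf : ∀ t, 0 < t → |f t| ≤ D * Real.exp (-n * t))
    (hD : 0 ≤ D) (hγ : 0 ≤ γ) (hn : 0 < n) (hγn : γ < n) (hs : 0 ≤ s) (hst : s ≤ t) :
    |u t| ≤ |u s| + D / (n * (n - γ)) * (Real.exp (-(n - γ) * s) - Real.exp (-(n - γ) * t)) := by
  refine abs_le'.2 ⟨le_abs_add_of_flux_le hu hC heq hq (fun t ht => (le_abs_self _).trans (hf t ht))
    hD hγ hn hγn hs hst, ?_⟩
  have := le_abs_add_of_flux_le (u := fun t => -u t) (f := fun t => -f t) hu.neg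
    (fun t ht => by rw [abs_neg]; exact hC t ht)
    (fun t ht => by
      have h := heq t ht
      have h1 : (fun s => Real.exp (-γ * s) * deriv (fun t => -u t) s)
          = fun s => -(Real.exp (-γ * s) * deriv u s) := by
        funext s; rw [deriv.fun_neg]; ring
      rw [h1, deriv.fun_neg]; linarith)
    hq (fun t ht => (neg_le_abs _).trans (hf t ht)) hD hγ hn hγn hs hst
  simpa using this

theorem contDiff_smul_of_tsupport_subset {E : Type*} [NormedAddCommGroup E] [NormedSpace ℝ E]
    {n : WithTop ℕ∞} {η : ℝ → ℝ} {g : ℝ → E} {s : Set ℝ} (hs : IsOpen s) (hη : ContDiff ℝ n η)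
    (hηs : tsupport η ⊆ s) (hg : ContDiffOn ℝ n g s) : ContDiff ℝ n (fun t => η t • g t) := by
  rw [contDiff_iff_contDiffAt]
  intro t
  by_cases ht : t ∈ tsupport η
  · exact hη.contDiffAt.smul (hg.contDiffAt (hs.mem_nhds (hηs ht)))
  · have h0 : (fun t => η t • g t) =ᶠ[𝓝 t] fun _ => (0 : E) := by
      filter_upwards [notMem_tsupport_iff_eventuallyEq.1 ht] with x hx
      simp [hx]
    exact contDiffAt_const.congr_of_eventuallyEq h0

/-! ### Homogeneous functions: Euler's identity and bounds by powers of the norm -/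

section Homogeneous

variable {E : Type*} [NormedAddCommGroup E] [NormedSpace ℝ E] {G : E → ℝ} {q : ℝ}

theorem fderiv_homogeneous (hG : ∀ (s : ℝ) (z : E), 0 < s → G (s • z) = s ^ q * G z)
    (hd : Differentiable ℝ G) {s : ℝ} (hs : 0 < s) (z w : E) :
    fderiv ℝ G (s • z) w = s ^ (q - 1) * fderiv ℝ G z w := by
  have h1 : HasFDerivAt (fun z' => G (s • z'))
      ((fderiv ℝ G (s • z)).comp (s • ContinuousLinearMap.id ℝ E)) z :=
    (hd (s • z)).hasFDerivAt.comp z ((hasFDerivAt_id z).const_smul s)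
  have h2 : HasFDerivAt (fun z' => G (s • z')) (s ^ q • fderiv ℝ G z) z := by
    have : (fun z' => G (s • z')) = fun z' => s ^ q * G z' := funext fun z' => hG s z' hs
    rw [this]
    exact (hd z).hasFDerivAt.const_mul _
  have h3 := congrArg (fun A : E →L[ℝ] ℝ => A w) (h1.unique h2)
  simp only [ContinuousLinearMap.comp_apply, _root_.smul_apply,
    ContinuousLinearMap.id_apply, map_smul, smul_eq_mul] at h3
  rw [Real.rpow_sub_one hs.ne']
  field_simp
  linarith

/-- Euler's identity: differentiate `s ↦ G (s • z)` at `s = 1` in two ways. -/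
theorem fderiv_apply_self_of_homogeneous
    (hG : ∀ (s : ℝ) (z : E), 0 < s → G (s • z) = s ^ q * G z)
    (hd : Differentiable ℝ G) (z : E) : fderiv ℝ G z z = q * G z := by
  have h1 : HasDerivAt (fun s : ℝ => G (s • z)) (fderiv ℝ G z z) 1 := by
    have h := ((hasDerivAt_id (1 : ℝ)).smul_const z)
    have h' : HasFDerivAt G (fderiv ℝ G z) (id (1 : ℝ) • z) := by
      simpa using (hd z).hasFDerivAt
    exact (h'.comp_hasDerivAt (1 : ℝ) h).congr_deriv (by simp)
  have h2 : HasDerivAt (fun s : ℝ => G (s • z)) (q * G z) 1 := by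
    have h := (Real.hasDerivAt_rpow_const (x := 1) (p := q) (Or.inl one_ne_zero)).mul_const (G z)
    simp only [Real.one_rpow, mul_one] at h
    refine h.congr_of_eventuallyEq ?_
    filter_upwards [lt_mem_nhds (zero_lt_one' ℝ)] with s hs using hG s z hs
  exact h1.unique h2

theorem homogeneous_zero (hG : ∀ (s : ℝ) (z : E), 0 < s → G (s • z) = s ^ q * G z)
    (hq : 0 < q) : G 0 = 0 := by
  have h := hG 2 0 two_pos
  rw [smul_zero] at h
  have h2 : (1 : ℝ) < 2 ^ q := Real.one_lt_rpow one_lt_two hq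
  have h3 : (2 ^ q - 1) * G 0 = 0 := by linarith
  exact (mul_eq_zero.1 h3).resolve_left (by linarith)

theorem homogeneous_eq_norm_rpow_mul
    (hG : ∀ (s : ℝ) (z : E), 0 < s → G (s • z) = s ^ q * G z) {z : E} (hz : z ≠ 0) :
    G z = ‖z‖ ^ q * G (‖z‖⁻¹ • z) := by
  rw [← hG _ _ (norm_pos_iff.2 hz), smul_smul, mul_inv_cancel₀ (norm_ne_zero_iff.2 hz), one_smul]

theorem inv_norm_smul_mem_sphere {z : E} (hz : z ≠ 0) : ‖z‖⁻¹ • z ∈ Metric.sphere (0 : E) 1 := by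
  rw [mem_sphere_zero_iff_norm, norm_smul, norm_inv, norm_norm,
    inv_mul_cancel₀ (norm_ne_zero_iff.2 hz)]

theorem exists_abs_le_of_homogeneous [ProperSpace E]
    (hG : ∀ (s : ℝ) (z : E), 0 < s → G (s • z) = s ^ q * G z) (hc : Continuous G) (hq : 0 < q) :
    ∃ C : ℝ, 0 < C ∧ ∀ z, |G z| ≤ C * ‖z‖ ^ q := by
  obtain ⟨C, hC⟩ := (isCompact_sphere (0 : E) 1).exists_bound_of_continuousOn hc.continuousOn
  refine ⟨max C 1, lt_max_of_lt_right one_pos, fun z => ?_⟩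
  rcases eq_or_ne z 0 with rfl | hz
  · simp [homogeneous_zero hG hq, Real.zero_rpow hq.ne']
  · rw [homogeneous_eq_norm_rpow_mul hG hz, abs_mul,
      abs_of_nonneg (Real.rpow_nonneg (norm_nonneg z) q), mul_comm]
    exact mul_le_mul_of_nonneg_right ((hC _ (inv_norm_smul_mem_sphere hz)).trans (le_max_left _ _))
      (Real.rpow_nonneg (norm_nonneg z) q)

theorem exists_le_of_homogeneous_pos [ProperSpace E] [Nontrivial E]
    (hG : ∀ (s : ℝ) (z : E), 0 < s → G (s • z) = s ^ q * G z) (hc : Continuous G) (hq : 0 < q)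
    (hpos : ∀ z, z ≠ 0 → 0 < G z) : ∃ c : ℝ, 0 < c ∧ ∀ z, c * ‖z‖ ^ q ≤ G z := by
  obtain ⟨z₀, hz₀, hmin⟩ := (isCompact_sphere (0 : E) 1).exists_isMinOn
    (NormedSpace.sphere_nonempty.2 zero_le_one) hc.continuousOn
  have hne : z₀ ≠ 0 := by
    rintro rfl
    simp at hz₀
  refine ⟨G z₀, hpos _ hne, fun z => ?_⟩
  rcases eq_or_ne z 0 with rfl | hz
  · simp [homogeneous_zero hG hq, Real.zero_rpow hq.ne']
  · rw [homogeneous_eq_norm_rpow_mul hG hz, mul_comm]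
    exact mul_le_mul_of_nonneg_left (hmin (inv_norm_smul_mem_sphere hz))
      (Real.rpow_nonneg (norm_nonneg z) q)

end Homogeneous

/-! ### Euler identities for the gradient and Hessian of `F` -/

namespace AssumptionF

variable {F : ℝ × ℝ → ℝ} {p : ℝ}

theorem differentiable (hF : AssumptionF F p) : Differentiable ℝ F :=
  hF.contDiff.differentiable (by norm_num)

theorem contDiff_fderiv_apply (hF : AssumptionF F p) (e : ℝ × ℝ) :
    ContDiff ℝ 1 (fun z => fderiv ℝ F z e) :=
  (hF.contDiff.fderiv_right (m := 1) (by norm_num)).clm_apply contDiff_const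

theorem homogeneous_fderiv (hF : AssumptionF F p) (e : ℝ × ℝ) (s : ℝ) (z : ℝ × ℝ) (hs : 0 < s) :
    fderiv ℝ F (s • z) e = s ^ (p - 1) * fderiv ℝ F z e :=
  fderiv_homogeneous hF.homogeneous hF.differentiable hs z e

theorem gradient_apply_self (hF : AssumptionF F p) (z : ℝ × ℝ) :
    partialU F z * z.1 + partialV F z * z.2 = p * F z := by
  rw [← fderiv_apply_self_of_homogeneous hF.homogeneous hF.differentiable z]
  have hz : z = z.1 • ((1, 0) : ℝ × ℝ) + z.2 • ((0, 1) : ℝ × ℝ) := by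
    ext <;> simp
  conv_rhs => rw [hz, map_add, map_smul, map_smul, ← hz]
  simp only [partialU, partialV, smul_eq_mul]
  ring

theorem fderiv_partial_apply_self (hF : AssumptionF F p) (e z : ℝ × ℝ) :
    partialU (fun z => fderiv ℝ F z e) z * z.1 + partialV (fun z => fderiv ℝ F z e) z * z.2
      = (p - 1) * fderiv ℝ F z e := by
  rw [← fderiv_apply_self_of_homogeneous (hF.homogeneous_fderiv e)
    ((hF.contDiff_fderiv_apply e).differentiable (by norm_num)) z]
  have hz : z = z.1 • ((1, 0) : ℝ × ℝ) + z.2 • ((0, 1) : ℝ × ℝ) := by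
    ext <;> simp
  conv_rhs => enter [2]; rw [hz]
  rw [map_add, map_smul, map_smul]
  simp only [partialU, partialV, smul_eq_mul]
  ring

theorem partialV_partialU (hF : AssumptionF F p) (z : ℝ × ℝ) :
    partialV (partialU F) z = partialU (partialV F) z := by
  have hd : DifferentiableAt ℝ (fderiv ℝ F) z :=
    (hF.contDiff.fderiv_right (m := 1) (by norm_num)).differentiable (by norm_num) z
  have key : ∀ a b : ℝ × ℝ, fderiv ℝ (fun z => fderiv ℝ F z a) z b
      = fderiv ℝ (fderiv ℝ F) z b a := by
    intro a b
    rw [fderiv_clm_apply hd (differentiableAt_const a)]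
    simp
  have hsymm := hF.contDiff.contDiffAt (x := z) |>.isSymmSndFDerivAt (by simp)
  change fderiv ℝ (fun z => fderiv ℝ F z (1, 0)) z (0, 1)
    = fderiv ℝ (fun z => fderiv ℝ F z (0, 1)) z (1, 0)
  rw [key, key]
  exact hsymm _ _

/-- Euler's identity applied twice: to the partial derivatives, of degree `p - 1`, and to `F`.
Symmetry of the second derivative identifies the mixed terms. -/
theorem hessian_quadratic (hF : AssumptionF F p) (z : ℝ × ℝ) :
    partialU (partialU F) z * z.1 ^ 2 + 2 * (partialV (partialU F) z * (z.1 * z.2))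
      + partialV (partialV F) z * z.2 ^ 2 = p * (p - 1) * F z := by
  have h1 : partialU (partialU F) z * z.1 + partialV (partialU F) z * z.2
      = (p - 1) * partialU F z := hF.fderiv_partial_apply_self (1, 0) z
  have h2 : partialU (partialV F) z * z.1 + partialV (partialV F) z * z.2
      = (p - 1) * partialV F z := hF.fderiv_partial_apply_self (0, 1) z
  have h3 := hF.partialV_partialU z
  have h4 := hF.gradient_apply_self z
  rw [← h3] at h2
  linear_combination z.1 * h1 + z.2 * h2 + (p - 1) * h4

end AssumptionF

/-! ### The stability inequality tested with multiples of the solution -/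

theorem inner_potential_smul {N : ℕ} {F : ℝ × ℝ → ℝ} {p μ₁ μ₂ β : ℝ} (hF : AssumptionF F p)
    (u v : ℝ → ℝ) (t e : ℝ) :
    inner ℝ (Matrix.toEuclideanLin (potential N F μ₁ μ₂ β u v t) (e • !₂[u t, v t]))
      (e • !₂[u t, v t])
      = e ^ 2 * (Real.exp (-N * t) * (p * (p - 1) * F (u t, v t))
        - β ^ 2 * Real.exp (-β * N * t) * (μ₁ * u t ^ 2 + μ₂ * v t ^ 2)) := by
  rw [← hF.hessian_quadratic]
  rw [map_smul, inner_smul_left, inner_smul_right, Matrix.toLpLin_toLp, PiLp.inner_apply,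
    Fin.sum_univ_two]
  simp [potential, hessian, Matrix.mulVec, dotProduct, Fin.sum_univ_two]
  ring

namespace IsBoundedSolution

variable {N : ℕ} {F : ℝ × ℝ → ℝ} {p lam μ₁ μ₂ β γ : ℝ} {u v : ℝ → ℝ}

theorem isTestFunction_smul (h : IsBoundedSolution N F μ₁ μ₂ β γ u v) {η : ℝ → ℝ}
    (hη : ContDiff ℝ 1 η) (hηc : HasCompactSupport η) (hηs : tsupport η ⊆ Ioi 0) :
    IsTestFunction (fun t => η t • !₂[u t, v t]) := by
  refine ⟨contDiff_smul_of_tsupport_subset isOpen_Ioi hη hηs ?_, hηc.smul_right, ?_⟩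
  · have hu := (h.contDiffOn_u.mono Ioi_subset_Ici_self).of_le (m := 1) (by norm_num)
    have hv := (h.contDiffOn_v.mono Ioi_subset_Ici_self).of_le (m := 1) (by norm_num)
    rw [contDiffOn_euclidean]
    intro i
    fin_cases i
    · exact hu
    · exact hv
  · exact (tsupport_smul_subset_left η _).trans hηs

/-- The system multiplied by `η² z` removes the terms in `z'` up to a total derivative. The `μ₁, μ₂`
terms cancel against those of the potential, and the `F` terms combine to `p - p(p-1) = -p(p-2)`. -/
theorem integral_potential_le (hF : AssumptionF F p) (h : IsBoundedSolution N F μ₁ μ₂ β γ u v)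
    {η : ℝ → ℝ} (hη : ContDiff ℝ 1 η) (hηc : HasCompactSupport η) (hηs : tsupport η ⊆ Ioi 0)
    (hQ : 0 ≤ quadForm N F lam μ₁ μ₂ β γ u v (fun t => η t • !₂[u t, v t])) :
    IntegrableOn (fun t => η t ^ 2 * (Real.exp (-N * t) * F (u t, v t))) (Ioi 0) ∧
    p * (p - 2) * ∫ t in Ioi (0 : ℝ), η t ^ 2 * (Real.exp (-N * t) * F (u t, v t)) ≤
      ∫ t in Ioi (0 : ℝ), Real.exp (-γ * t) * (deriv η t ^ 2 + lam * β ^ 2 * η t ^ 2)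
        * (u t ^ 2 + v t ^ 2) := by
  have hu2 : ContDiffOn ℝ 2 u (Ioi 0) := h.contDiffOn_u.mono Ioi_subset_Ici_self
  have hv2 : ContDiffOn ℝ 2 v (Ioi 0) := h.contDiffOn_v.mono Ioi_subset_Ici_self
  have hu1 : ContDiffOn ℝ 1 (deriv u) (Ioi 0) := hu2.deriv_of_isOpen isOpen_Ioi (by norm_num)
  have hv1 : ContDiffOn ℝ 1 (deriv v) (Ioi 0) := hv2.deriv_of_isOpen isOpen_Ioi (by norm_num)
  have hexp : ∀ c : ℝ, ContDiff ℝ 1 (fun t => Real.exp (c * t)) := fun c => by fun_prop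
  have hcont : ∀ {η g : ℝ → ℝ}, Continuous η → tsupport η ⊆ Ioi 0 → ContinuousOn g (Ioi 0) →
      Continuous (fun t => η t * g t) := by
    intro η g h1 h2 h3
    exact (contDiff_smul_of_tsupport_subset (n := 0) isOpen_Ioi (contDiff_zero.2 h1) h2
      (contDiffOn_zero.2 h3)).continuous
  have hη2c : HasCompactSupport (fun t => η t ^ 2) :=
    hηc.comp_left (g := fun x => x ^ 2) (by simp)
  have hη2s : tsupport (fun t => η t ^ 2) ⊆ Ioi 0 :=
    (closure_mono (fun t ht => by simpa using ht)).trans hηs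
  have hη2 : ContDiff ℝ 1 (fun t => η t ^ 2) := hη.pow 2
  have hdηc : HasCompactSupport (deriv η) := hηc.deriv
  have hdη : Continuous (deriv η) := hη.continuous_deriv le_rfl
  have hFc : ContinuousOn (fun t => F (u t, v t)) (Ioi 0) :=
    hF.contDiff.continuous.comp_continuousOn (hu2.continuousOn.prodMk hv2.continuousOn)
  -- The boundary term `η² e^{-γt} ⟨z', z⟩` of the integration by parts; its derivative integrates
  -- to zero.
  set B : ℝ → ℝ := fun t => η t ^ 2 * (Real.exp (-γ * t) * (deriv u t * u t + deriv v t * v t))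
    with hB
  have hBC : ContDiff ℝ 1 B :=
    contDiff_smul_of_tsupport_subset isOpen_Ioi hη2 hη2s ((hexp _).contDiffOn.mul
      ((hu1.mul (hu2.of_le (by norm_num))).add (hv1.mul (hv2.of_le (by norm_num)))))
  have hBc : HasCompactSupport B := hη2c.mul_right
  have hBi : IntegrableOn (deriv B) (Ioi 0) :=
    ((hBC.continuous_deriv le_rfl).integrable_of_hasCompactSupport hBc.deriv).integrableOn
  have hB0 : ∫ t in Ioi (0 : ℝ), deriv B t = 0 := by
    rw [hBc.integral_Ioi_deriv_eq hBC]
    have : η 0 = 0 := image_eq_zero_of_notMem_tsupport fun h0 => lt_irrefl (0 : ℝ) (hηs h0)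
    simp [hB, this]
  have hPi : IntegrableOn (fun t => η t ^ 2 * (Real.exp (-N * t) * F (u t, v t))) (Ioi 0) :=
    ((hcont hη2.continuous hη2s ((hexp _).continuous.continuousOn.mul hFc)
      ).integrable_of_hasCompactSupport hη2c.mul_right).integrableOn
  have hw : HasCompactSupport (fun t => deriv η t ^ 2 + lam * β ^ 2 * η t ^ 2) :=
    (hdηc.comp_left (g := fun x => x ^ 2) (by simp)).add hη2c.mul_left
  have hws : tsupport (fun t => deriv η t ^ 2 + lam * β ^ 2 * η t ^ 2) ⊆ Ioi 0 := by
    refine (closure_minimal (fun t ht => ?_) (isClosed_tsupport η)).trans hηs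
    by_contra hn
    have h1 := image_eq_zero_of_notMem_tsupport hn
    have h2 : deriv η t = 0 :=
      image_eq_zero_of_notMem_tsupport fun h' => hn (tsupport_deriv_subset h')
    simp [h1, h2] at ht
  have hRi : IntegrableOn (fun t => Real.exp (-γ * t)
      * (deriv η t ^ 2 + lam * β ^ 2 * η t ^ 2) * (u t ^ 2 + v t ^ 2)) (Ioi 0) := by
    have hc := (hcont (η := fun t => deriv η t ^ 2 + lam * β ^ 2 * η t ^ 2)
      (g := fun t => Real.exp (-γ * t) * (u t ^ 2 + v t ^ 2))
      ((hdη.pow 2).add (continuous_const.mul hη2.continuous)) hws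
      ((hexp _).continuous.continuousOn.mul
        ((hu2.continuousOn.pow 2).add (hv2.continuousOn.pow 2)))).integrable_of_hasCompactSupport (μ := volume)
      hw.mul_right
    refine (hc.congr (ae_of_all _ fun t => ?_)).integrableOn
    simp only; ring
  refine ⟨hPi, ?_⟩
  have hQeq : quadForm N F lam μ₁ μ₂ β γ u v (fun t => η t • !₂[u t, v t])
      = ∫ t in Ioi (0 : ℝ), (deriv B t + Real.exp (-γ * t)
        * (deriv η t ^ 2 + lam * β ^ 2 * η t ^ 2) * (u t ^ 2 + v t ^ 2)
        - p * (p - 2) * (η t ^ 2 * (Real.exp (-N * t) * F (u t, v t)))) := by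
    refine setIntegral_congr_fun measurableSet_Ioi fun t ht => ?_
    have ht0 : (0 : ℝ) < t := ht
    have hud : HasDerivAt u (deriv u t) t :=
      ((hu2.differentiableOn (by norm_num)).differentiableAt (Ioi_mem_nhds ht0)).hasDerivAt
    have hvd : HasDerivAt v (deriv v t) t :=
      ((hv2.differentiableOn (by norm_num)).differentiableAt (Ioi_mem_nhds ht0)).hasDerivAt
    have hηd : HasDerivAt η (deriv η t) t := (hη.differentiable one_ne_zero t).hasDerivAt
    have hud1 : HasDerivAt (fun s => Real.exp (-γ * s) * deriv u s)
        (deriv (fun s => Real.exp (-γ * s) * deriv u s) t) t :=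
      (((hexp (-γ)).differentiable one_ne_zero t).mul
        ((hu1.differentiableOn one_ne_zero).differentiableAt (Ioi_mem_nhds ht0))).hasDerivAt
    have hvd1 : HasDerivAt (fun s => Real.exp (-γ * s) * deriv v s)
        (deriv (fun s => Real.exp (-γ * s) * deriv v s) t) t :=
      (((hexp (-γ)).differentiable one_ne_zero t).mul
        ((hv1.differentiableOn one_ne_zero).differentiableAt (Ioi_mem_nhds ht0))).hasDerivAt
    have hz : HasDerivAt (fun t => !₂[u t, v t]) !₂[deriv u t, deriv v t] t := by
      rw [hasDerivAt_iff_hasFDerivAt, ← hasFDerivWithinAt_univ, hasFDerivWithinAt_euclidean]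
      intro i
      fin_cases i
      · exact hud.hasFDerivAt.hasFDerivWithinAt.congr_fderiv (by ext; simp)
      · exact hvd.hasFDerivAt.hasFDerivWithinAt.congr_fderiv (by ext; simp)
    have hφ : deriv (fun t => η t • !₂[u t, v t]) t
        = !₂[η t * deriv u t + deriv η t * u t, η t * deriv v t + deriv η t * v t] := by
      rw [(hηd.fun_smul hz).deriv]
      ext i
      fin_cases i <;> simp
    have hBd : deriv B t = 2 * η t * deriv η t
          * (Real.exp (-γ * t) * (deriv u t * u t + deriv v t * v t))
        + η t ^ 2 * (deriv (fun s => Real.exp (-γ * s) * deriv u s) t * u t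
          + Real.exp (-γ * t) * deriv u t * deriv u t
          + (deriv (fun s => Real.exp (-γ * s) * deriv v s) t * v t
          + Real.exp (-γ * t) * deriv v t * deriv v t)) := by
      have hBe : B = fun t => η t ^ 2 * ((Real.exp (-γ * t) * deriv u t) * u t
          + (Real.exp (-γ * t) * deriv v t) * v t) := by
        funext t; simp only [hB]; ring
      rw [hBe]
      refine (((hηd.fun_pow 2).fun_mul
        ((hud1.fun_mul hud).fun_add (hvd1.fun_mul hvd))).congr_deriv ?_).deriv
      push_cast
      ring
    have e1 := h.eq_u t ht0
    have e2 := h.eq_v t ht0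
    have e3 := hF.gradient_apply_self (u t, v t)
    simp only at e3
    simp only
    rw [inner_potential_smul hF, hφ, hBd, norm_smul, mul_pow, EuclideanSpace.real_norm_sq_eq,
      EuclideanSpace.real_norm_sq_eq, Fin.sum_univ_two, Fin.sum_univ_two, Real.norm_eq_abs, sq_abs]
    simp only [Matrix.cons_val_zero, Matrix.cons_val_one]
    linear_combination η t ^ 2 * u t * e1 + η t ^ 2 * v t * e2
      + η t ^ 2 * Real.exp (-N * t) * e3
  have hsum : IntegrableOn (fun t => deriv B t + Real.exp (-γ * t)
      * (deriv η t ^ 2 + lam * β ^ 2 * η t ^ 2) * (u t ^ 2 + v t ^ 2)) (Ioi 0) := hBi.add hRi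
  rw [hQeq, integral_sub hsum (hPi.const_mul _), integral_add hBi hRi, hB0,
    integral_const_mul] at hQ
  linarith

end IsBoundedSolution

/-! ### Cutoff functions -/

theorem deriv_smoothTransition_eq_zero {x : ℝ} (hx : x ∉ Icc (0 : ℝ) 1) :
    deriv Real.smoothTransition x = 0 := by
  rcases lt_or_ge x 0 with h | h
  · have : Real.smoothTransition =ᶠ[𝓝 x] fun _ => 0 := by
      filter_upwards [gt_mem_nhds h] with y hy using Real.smoothTransition.zero_of_nonpos hy.le
    rw [this.deriv_eq, deriv_const]
  · have h1 : 1 < x := by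
      by_contra! h1
      exact hx ⟨h, h1⟩
    have : Real.smoothTransition =ᶠ[𝓝 x] fun _ => 1 := by
      filter_upwards [lt_mem_nhds h1] with y hy using Real.smoothTransition.one_of_one_le hy.le
    rw [this.deriv_eq, deriv_const]

theorem exists_abs_deriv_smoothTransition_le :
    ∃ C : ℝ, 0 ≤ C ∧ ∀ x, |deriv Real.smoothTransition x| ≤ C := by
  obtain ⟨C, hC⟩ := (isCompact_Icc (a := (0 : ℝ)) (b := 1)).exists_bound_of_continuousOn
    ((Real.smoothTransition.contDiff (n := 1)).continuous_deriv le_rfl).continuousOn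
  have hC0 : 0 ≤ C := (norm_nonneg _).trans (hC 0 (by simp))
  refine ⟨C, hC0, fun x => ?_⟩
  by_cases hx : x ∈ Icc (0 : ℝ) 1
  · exact hC x hx
  · rwa [deriv_smoothTransition_eq_zero hx, abs_zero]

/-- A `C¹` cutoff at scale `1/ε` around `s`, which in addition vanishes near `0` at scale `δ`. -/
theorem exists_cutoff : ∃ A : ℝ, 0 < A ∧ ∀ ε s δ : ℝ, 0 < ε → 0 < δ → 2 * δ ≤ s →
    ∃ θ : ℝ → ℝ, ContDiff ℝ 1 θ ∧ HasCompactSupport θ ∧ tsupport θ ⊆ Ioi 0 ∧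
      tsupport θ ⊆ Icc (s - 2 / ε) (s + 2 / ε) ∧ (∀ t, 0 ≤ θ t ∧ θ t ≤ 1) ∧
      (∀ t, s ≤ t → t ≤ s + 1 / ε → θ t = 1) ∧
      ∀ t, deriv θ t ^ 2 ≤ A * ε ^ 2 + (Icc δ (2 * δ)).indicator (fun _ => A / δ ^ 2) t := by
  obtain ⟨C, hC0, hC⟩ := exists_abs_deriv_smoothTransition_le
  -- `(εa + b/δ)² ≤ 2ε²a² + 2b²/δ²` with `|a| ≤ 2C` and `|b| ≤ C` requires `8C²`; the `1` secures
  -- positivity.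
  refine ⟨8 * C ^ 2 + 1, by positivity, fun ε s δ hε hδ hs => ?_⟩
  set S := Real.smoothTransition with hS
  have hS1 : ContDiff ℝ 1 S := Real.smoothTransition.contDiff
  have hS0 : ∀ x, x ≤ 0 → S x = 0 := fun x => Real.smoothTransition.zero_of_nonpos
  have hSn : ∀ x, 0 ≤ S x := Real.smoothTransition.nonneg
  have hSl : ∀ x, S x ≤ 1 := Real.smoothTransition.le_one
  -- The first two factors localize to `|t - s| ≤ 2/ε`, which may reach past `0`; the third then
  -- keeps the support in `[δ, ∞)`.
  set θ : ℝ → ℝ := fun t => S (2 - ε * (t - s)) * S (2 + ε * (t - s)) * S (t / δ - 1) with hθ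
  have hsupp : Function.support θ ⊆ Icc (s - 2 / ε) (s + 2 / ε) ∩ Ici δ := by
    intro t ht
    simp only [hθ, Function.mem_support, ne_eq, mul_eq_zero, not_or] at ht
    have h1 : 0 < 2 - ε * (t - s) := by
      by_contra! h; exact ht.1.1 (hS0 _ h)
    have h2 : 0 < 2 + ε * (t - s) := by
      by_contra! h; exact ht.1.2 (hS0 _ h)
    have h3 : 0 < t / δ - 1 := by
      by_contra! h; exact ht.2 (hS0 _ h)
    refine ⟨⟨?_, ?_⟩, ?_⟩
    · have : s - t ≤ 2 / ε := by rw [le_div_iff₀ hε]; linarith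
      linarith
    · have : t - s ≤ 2 / ε := by rw [le_div_iff₀ hε]; linarith
      linarith
    · have : 1 < t / δ := by linarith
      rw [one_lt_div hδ] at this
      exact this.le
  have hts : tsupport θ ⊆ Icc (s - 2 / ε) (s + 2 / ε) ∩ Ici δ :=
    closure_minimal hsupp (isClosed_Icc.inter isClosed_Ici)
  refine ⟨θ, ?_, ?_, ?_, ?_, ?_, ?_, ?_⟩
  · exact ((hS1.comp (by fun_prop)).mul (hS1.comp (by fun_prop))).mul (hS1.comp (by fun_prop))
  · exact HasCompactSupport.of_support_subset_isCompact isCompact_Icc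
      (hsupp.trans inter_subset_left)
  · exact fun t ht => lt_of_lt_of_le hδ (hts ht).2
  · exact hts.trans inter_subset_left
  · exact fun t => ⟨mul_nonneg (mul_nonneg (hSn _) (hSn _)) (hSn _),
      mul_le_one₀ (mul_le_one₀ (hSl _) (hSn _) (hSl _)) (hSn _) (hSl _)⟩
  · intro t h1 h2
    have h3 : ε * (t - s) ≤ 1 := by
      have : t - s ≤ 1 / ε := by linarith
      rw [le_div_iff₀ hε] at this
      linarith
    have h4 : 0 ≤ ε * (t - s) := mul_nonneg hε.le (by linarith)
    have h5 : 2 ≤ t / δ := by rw [le_div_iff₀ hδ]; linarith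
    simp only [hθ, hS]
    rw [Real.smoothTransition.one_of_one_le (by linarith),
      Real.smoothTransition.one_of_one_le (by linarith),
      Real.smoothTransition.one_of_one_le (by linarith)]
    norm_num
  · intro t
    have hSd : ∀ x, HasDerivAt S (deriv S x) x := fun x =>
      (hS1.differentiable one_ne_zero x).hasDerivAt
    have d1 : HasDerivAt (fun t => S (2 - ε * (t - s))) (deriv S (2 - ε * (t - s)) * -ε) t := by
      refine (hSd _).comp t ?_
      simpa using (((hasDerivAt_id t).sub_const s).const_mul ε).const_sub 2
    have d2 : HasDerivAt (fun t => S (2 + ε * (t - s))) (deriv S (2 + ε * (t - s)) * ε) t := by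
      refine (hSd _).comp t ?_
      simpa using (((hasDerivAt_id t).sub_const s).const_mul ε).const_add 2
    have d3 : HasDerivAt (fun t => S (t / δ - 1)) (deriv S (t / δ - 1) * (1 / δ)) t := by
      refine (hSd _).comp t ?_
      simpa using ((hasDerivAt_id t).div_const δ).sub_const 1
    have hd := ((d1.fun_mul d2).fun_mul d3).deriv
    have habs : ∀ x y z, |deriv S x * S y * S z| ≤ C := by
      intro x y z
      rw [abs_mul, abs_mul, abs_of_nonneg (hSn y), abs_of_nonneg (hSn z)]
      exact (mul_le_of_le_one_right (mul_nonneg (abs_nonneg _) (hSn y)) (hSl z)).trans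
        ((mul_le_of_le_one_right (abs_nonneg _) (hSl y)).trans (hC x))
    set x₁ := 2 - ε * (t - s)
    set x₂ := 2 + ε * (t - s)
    set x₃ := t / δ - 1 with hx₃
    have e : deriv θ t = ε * (deriv S x₂ * S x₁ * S x₃ - deriv S x₁ * S x₂ * S x₃)
        + (deriv S x₃ * S x₁ * S x₂) * (1 / δ) := by
      rw [hd]; ring
    set a := deriv S x₂ * S x₁ * S x₃ - deriv S x₁ * S x₂ * S x₃ with ha
    set b := deriv S x₃ * S x₁ * S x₂ with hb
    have ha2 : a ^ 2 ≤ 4 * C ^ 2 := by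
      have h1 : |a| ≤ 2 * C := (abs_sub _ _).trans (by linarith [habs x₂ x₁ x₃, habs x₁ x₂ x₃])
      have := sq_le_sq' (abs_le.1 h1).1 (abs_le.1 h1).2
      linarith
    have hb2 : (b * (1 / δ)) ^ 2 ≤ (Icc δ (2 * δ)).indicator (fun _ => C ^ 2 / δ ^ 2) t := by
      by_cases ht : t ∈ Icc δ (2 * δ)
      · rw [indicator_of_mem ht, mul_pow, div_pow, one_pow, mul_one_div]
        have h1 := habs x₃ x₁ x₂
        have := sq_le_sq' (abs_le.1 h1).1 (abs_le.1 h1).2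
        gcongr
      · rw [indicator_of_notMem ht]
        have : x₃ ∉ Icc (0 : ℝ) 1 := by
          intro h
          refine ht ⟨?_, ?_⟩
          · have : 1 ≤ t / δ := by linarith [h.1]
            rwa [one_le_div hδ] at this
          · have : t / δ ≤ 2 := by linarith [h.2]
            rwa [div_le_iff₀ hδ] at this
        rw [hb, hS, deriv_smoothTransition_eq_zero this]
        simp
    have hind : 2 * (Icc δ (2 * δ)).indicator (fun _ => C ^ 2 / δ ^ 2) t
        ≤ (Icc δ (2 * δ)).indicator (fun _ => (8 * C ^ 2 + 1) / δ ^ 2) t := by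
      by_cases ht : t ∈ Icc δ (2 * δ)
      · rw [indicator_of_mem ht, indicator_of_mem ht, ← mul_div_assoc]
        gcongr
        nlinarith [sq_nonneg C]
      · simp [indicator_of_notMem ht]
    rw [e]
    have h1 : ε ^ 2 * a ^ 2 ≤ ε ^ 2 * (4 * C ^ 2) := by gcongr
    nlinarith [sq_nonneg (ε * a - b * (1 / δ)), sq_nonneg ε]

/-! ### Growth of the solution against the weight, and the cutoff energy -/

namespace IsBoundedSolution

variable {N : ℕ} {F : ℝ × ℝ → ℝ} {p lam μ₁ μ₂ β γ : ℝ} {u v : ℝ → ℝ}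

/-- The norm on `ℝ × ℝ` is the maximum norm, so the scalar estimate for each component suffices. -/
theorem norm_le_norm_add (h : IsBoundedSolution N F μ₁ μ₂ β γ u v) {D s t : ℝ}
    (hμ₁ : 0 ≤ μ₁) (hμ₂ : 0 ≤ μ₂) (hγ : 0 ≤ γ) (hγN : γ < N)
    (hD : ∀ t, 0 ≤ t → |partialU F (u t, v t)| ≤ D ∧ |partialV F (u t, v t)| ≤ D)
    (hs : 0 ≤ s) (hst : s ≤ t) :
    ‖(u t, v t)‖ ≤ ‖(u s, v s)‖
      + D / (N * (N - γ)) * (Real.exp (-(N - γ) * s) - Real.exp (-(N - γ) * t)) := by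
  obtain ⟨C, hC⟩ := h.bounded
  have hD0 : 0 ≤ D := (abs_nonneg _).trans (hD 0 le_rfl).1
  have hu := abs_le_abs_add_of_flux (n := N) (D := D)
    (q := fun t => β ^ 2 * Real.exp (-β * N * t) * μ₁)
    h.contDiffOn_u (fun t ht => (hC t ht).1) h.eq_u (fun t _ => by positivity)
    (fun t ht => by
      rw [abs_mul, Real.abs_exp, mul_comm]
      exact mul_le_mul_of_nonneg_right (hD t ht.le).1 (Real.exp_pos _).le)
    hD0 hγ (hγ.trans_lt hγN) hγN hs hst
  have hv := abs_le_abs_add_of_flux (n := N) (D := D)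
    (q := fun t => β ^ 2 * Real.exp (-β * N * t) * μ₂)
    h.contDiffOn_v (fun t ht => (hC t ht).2) h.eq_v (fun t _ => by positivity)
    (fun t ht => by
      rw [abs_mul, Real.abs_exp, mul_comm]
      exact mul_le_mul_of_nonneg_right (hD t ht.le).2 (Real.exp_pos _).le)
    hD0 hγ (hγ.trans_lt hγN) hγN hs hst
  simp only [Prod.norm_mk, Real.norm_eq_abs]
  exact max_le (hu.trans (by gcongr; exact le_max_left _ _))
    (hv.trans (by gcongr; exact le_max_right _ _))

end IsBoundedSolution

/-- Near a point where `r` is at least half of its maximum `M` there is an interval `[s₀, t₁]` of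
length at most `1` on which `r ≥ M / 4` and which carries a definite amount of the weight
`e^{-at}`. -/
theorem exists_interval_of_increment {r : ℝ → ℝ} {a E M t₀ : ℝ} (ha : 1 ≤ a) (hE : 0 < E)
    (hM : 0 < M) (hr0 : r 0 = 0) (ht₀ : 0 ≤ t₀) (hrt₀ : M / 2 ≤ r t₀)
    (hr : ∀ s t, 0 ≤ s → s ≤ t → r t ≤ r s + E * (Real.exp (-a * s) - Real.exp (-a * t))) :
    ∃ s₀ t₁, 0 < s₀ ∧ s₀ ≤ t₁ ∧ t₁ ≤ s₀ + 1 ∧ (∀ t ∈ Icc s₀ t₁, M / 4 ≤ r t) ∧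
      M / 8 ≤ E * (Real.exp (-a * s₀) - Real.exp (-a * t₁)) := by
  have h0 := hr 0 t₀ le_rfl ht₀
  rw [hr0, zero_add] at h0
  -- `s₀` is chosen so that exactly `M/4` of admissible growth remains before `t₀`; hence `r ≥ M/2 -
  -- M/4` on `[s₀, t₀]`.
  obtain ⟨s₀, hs₀, he⟩ : M / 4 ∈
      (fun s => E * (Real.exp (-a * s) - Real.exp (-a * t₀))) '' Icc 0 t₀ := by
    refine intermediate_value_Icc' ht₀ (by fun_prop) ⟨?_, ?_⟩
    · simp only [sub_self, mul_zero]; linarith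
    · exact (by linarith : M / 4 ≤ M / 2).trans (hrt₀.trans h0)
  simp only at he
  have hs₀pos : 0 < s₀ := by
    refine lt_of_le_of_ne hs₀.1 ?_
    rintro rfl
    linarith
  have hexp : ∀ x y, x ≤ y → Real.exp (-a * y) ≤ Real.exp (-a * x) := fun x y hxy =>
    Real.exp_le_exp.2 (by nlinarith)
  -- Length at most `1` will fit the plateau of the cutoff. Truncating costs at most half of the
  -- `M/4`, since `e^{-a} ≤ 1/2`.
  refine ⟨s₀, min t₀ (s₀ + 1), hs₀pos, le_min hs₀.2 (by linarith), min_le_right _ _, ?_, ?_⟩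
  · intro t ht
    have htt : t ≤ t₀ := ht.2.trans (min_le_left _ _)
    have h1 := hr t t₀ (hs₀.1.trans ht.1) htt
    have h2 : E * (Real.exp (-a * t) - Real.exp (-a * t₀))
        ≤ E * (Real.exp (-a * s₀) - Real.exp (-a * t₀)) := by
      have := hexp s₀ t ht.1
      gcongr
    linarith
  · rcases min_cases t₀ (s₀ + 1) with ⟨h1, -⟩ | ⟨h1, -⟩
    · rw [h1, he]; linarith
    · rw [h1]
      have e1 : Real.exp (-a * (s₀ + 1)) = Real.exp (-a * s₀) * Real.exp (-a) := by
        rw [← Real.exp_add]; congr 1; ring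
      have e2 : Real.exp (-a) ≤ 1 / 2 := by
        have h3 : 2 ≤ Real.exp a := by linarith [Real.add_one_le_exp a]
        rw [Real.exp_neg, one_div]
        exact inv_anti₀ two_pos h3
      have e3 : M / 4 ≤ E * Real.exp (-a * s₀) := by
        have := mul_pos hE (Real.exp_pos (-a * t₀))
        linarith
      rw [e1]
      have := mul_le_mul_of_nonneg_left e2 (mul_pos hE (Real.exp_pos (-a * s₀))).le
      linarith

/-- Upper bound for the right-hand side of the stability inequality with the test function
`e^{γt/2} θ`, `θ` a cutoff at scale `1/ε`. -/
theorem integral_cutoff_le {u v θ : ℝ → ℝ} {γ ε s₀ δ A M L b : ℝ} (hγ : 0 ≤ γ) (hγε : γ ≤ ε)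
    (hε : 0 < ε) (hδ : 0 < δ) (hA : 0 < A) (hb : 0 ≤ b)
    (hθ : Differentiable ℝ θ) (hθs : tsupport θ ⊆ Icc (s₀ - 2 / ε) (s₀ + 2 / ε))
    (hθ1 : ∀ t, 0 ≤ θ t ∧ θ t ≤ 1)
    (hθd : ∀ t, deriv θ t ^ 2 ≤ A * ε ^ 2 + (Icc δ (2 * δ)).indicator (fun _ => A / δ ^ 2) t)
    (hM : ∀ t, 0 ≤ t → u t ^ 2 + v t ^ 2 ≤ 2 * M ^ 2)
    (hL : ∀ t, 0 ≤ t → u t ^ 2 + v t ^ 2 ≤ 2 * (L * t) ^ 2) :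
    ∫ t in Ioi (0 : ℝ), Real.exp (-γ * t) * (deriv (fun t => Real.exp (γ / 2 * t) * θ t) t ^ 2
        + b * ε ^ 2 * (Real.exp (γ / 2 * t) * θ t) ^ 2) * (u t ^ 2 + v t ^ 2)
      ≤ 8 * M ^ 2 * ε * (1 + 2 * A + b) + 16 * A * L ^ 2 * δ := by
  set c₁ := 2 * M ^ 2 * (ε ^ 2 * (1 + 2 * A + b)) with hc₁
  -- On `[δ, 2δ]` the term `2A/δ²` meets `|z|² ≤ 2(2Lδ)²`: linear vanishing at `0` makes the product
  -- independent of `δ`, and integration leaves a factor `δ`.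
  set c₂ := 16 * A * L ^ 2 with hc₂
  set I := Icc (s₀ - 2 / ε) (s₀ + 2 / ε)
  have hc₁0 : 0 ≤ c₁ := by positivity
  have hc₂0 : 0 ≤ c₂ := by positivity
  have hi₁ : Integrable (I.indicator fun _ => c₁) :=
    (integrable_indicator_iff measurableSet_Icc).2 (integrableOn_const (by simp))
  have hi₂ : Integrable ((Icc δ (2 * δ)).indicator fun _ => c₂) :=
    (integrable_indicator_iff measurableSet_Icc).2 (integrableOn_const (by simp))
  have hn₁ : ∀ t, 0 ≤ I.indicator (fun _ => c₁) t := fun t =>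
    indicator_nonneg (fun _ _ => hc₁0) t
  have hn₂ : ∀ t, 0 ≤ (Icc δ (2 * δ)).indicator (fun _ => c₂) t := fun t =>
    indicator_nonneg (fun _ _ => hc₂0) t
  have hpt : ∀ t, 0 < t → Real.exp (-γ * t) * (deriv (fun t => Real.exp (γ / 2 * t) * θ t) t ^ 2
        + b * ε ^ 2 * (Real.exp (γ / 2 * t) * θ t) ^ 2) * (u t ^ 2 + v t ^ 2)
      ≤ I.indicator (fun _ => c₁) t + (Icc δ (2 * δ)).indicator (fun _ => c₂) t := by
    intro t ht
    have hd : deriv (fun t => Real.exp (γ / 2 * t) * θ t) t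
        = Real.exp (γ / 2 * t) * (γ / 2 * θ t + deriv θ t) := by
      have h1 : HasDerivAt (fun t => Real.exp (γ / 2 * t)) (Real.exp (γ / 2 * t) * (γ / 2)) t := by
        simpa using ((hasDerivAt_id t).const_mul (γ / 2)).exp
      rw [(h1.fun_mul (hθ t).hasDerivAt).deriv]
      ring
    have he : Real.exp (-γ * t) * Real.exp (γ / 2 * t) ^ 2 = 1 := by
      rw [← Real.exp_nat_mul, ← Real.exp_add, Real.exp_eq_one_iff]
      push_cast; ring
    have hre : Real.exp (-γ * t) * (deriv (fun t => Real.exp (γ / 2 * t) * θ t) t ^ 2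
        + b * ε ^ 2 * (Real.exp (γ / 2 * t) * θ t) ^ 2) * (u t ^ 2 + v t ^ 2)
        = ((γ / 2 * θ t + deriv θ t) ^ 2 + b * ε ^ 2 * θ t ^ 2) * (u t ^ 2 + v t ^ 2) := by
      rw [hd]
      linear_combination ((γ / 2 * θ t + deriv θ t) ^ 2 + b * ε ^ 2 * θ t ^ 2)
        * (u t ^ 2 + v t ^ 2) * he
    rw [hre]
    by_cases htI : t ∈ I
    · rw [indicator_of_mem htI]
      have hr0 : 0 ≤ u t ^ 2 + v t ^ 2 := by positivity
      have hθ2 : θ t ^ 2 ≤ 1 := pow_le_one₀ (hθ1 t).1 (hθ1 t).2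
      have hγ2 : γ ^ 2 ≤ ε ^ 2 := pow_le_pow_left₀ hγ hγε 2
      have h1 : (γ / 2 * θ t + deriv θ t) ^ 2 + b * ε ^ 2 * θ t ^ 2
          ≤ ε ^ 2 * (1 + 2 * A + b)
            + 2 * (Icc δ (2 * δ)).indicator (fun _ => A / δ ^ 2) t := by
        have h2 : γ ^ 2 * θ t ^ 2 ≤ ε ^ 2 * 1 := by gcongr
        have h3 : b * ε ^ 2 * θ t ^ 2 ≤ b * ε ^ 2 * 1 := by gcongr
        have h4 := hθd t
        nlinarith [sq_nonneg (γ / 2 * θ t - deriv θ t), sq_nonneg (γ * θ t)]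
      have h5 : 2 * (Icc δ (2 * δ)).indicator (fun _ => A / δ ^ 2) t * (u t ^ 2 + v t ^ 2)
          ≤ (Icc δ (2 * δ)).indicator (fun _ => c₂) t := by
        by_cases htd : t ∈ Icc δ (2 * δ)
        · rw [indicator_of_mem htd, indicator_of_mem htd]
          have h6 : t ^ 2 ≤ (2 * δ) ^ 2 := pow_le_pow_left₀ ht.le htd.2 2
          have h7 : u t ^ 2 + v t ^ 2 ≤ 8 * L ^ 2 * δ ^ 2 := by
            have := hL t ht.le
            nlinarith [mul_le_mul_of_nonneg_left h6 (sq_nonneg L)]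
          calc 2 * (A / δ ^ 2) * (u t ^ 2 + v t ^ 2)
              ≤ 2 * (A / δ ^ 2) * (8 * L ^ 2 * δ ^ 2) := by gcongr
            _ = c₂ := by rw [hc₂]; field_simp; ring
        · simp [indicator_of_notMem htd]
      have h8 : ε ^ 2 * (1 + 2 * A + b) * (u t ^ 2 + v t ^ 2) ≤ c₁ := by
        rw [hc₁, mul_comm (2 * M ^ 2)]
        exact mul_le_mul_of_nonneg_left (hM t ht.le) (by positivity)
      have := mul_le_mul_of_nonneg_right h1 hr0
      linarith
    · have h1 : t ∉ tsupport θ := fun h => htI (hθs h)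
      rw [image_eq_zero_of_notMem_tsupport h1,
        image_eq_zero_of_notMem_tsupport fun h => h1 (tsupport_deriv_subset h)]
      have := hn₁ t
      have := hn₂ t
      simp only [mul_zero, add_zero, ne_eq, OfNat.ofNat_ne_zero, not_false_eq_true, zero_pow,
        zero_mul]
      linarith
  have hbound : ∫ t, (I.indicator (fun _ => c₁) t + (Icc δ (2 * δ)).indicator (fun _ => c₂) t)
      = 8 * M ^ 2 * ε * (1 + 2 * A + b) + 16 * A * L ^ 2 * δ := by
    have h2 : 0 ≤ 2 / ε := by positivity
    rw [integral_add hi₁ hi₂, integral_indicator_const _ measurableSet_Icc,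
      integral_indicator_const _ measurableSet_Icc, Real.volume_real_Icc_of_le (by linarith),
      Real.volume_real_Icc_of_le (by linarith), smul_eq_mul, smul_eq_mul, hc₁, hc₂]
    field_simp
    ring
  rw [← hbound]
  refine (integral_mono_of_nonneg ?_ (hi₁.add hi₂).integrableOn ?_).trans
    (setIntegral_le_integral (hi₁.add hi₂) (ae_of_all _ fun t => add_nonneg (hn₁ t) (hn₂ t)))
  · exact ae_of_all _ fun t => by simp only [Pi.zero_apply]; positivity
  · exact (ae_restrict_iff' measurableSet_Ioi).2 (ae_of_all _ hpt)

/-! ### The lower bound for `β + γ` and the conclusion -/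

namespace IsBoundedSolution

variable {N : ℕ} {F : ℝ × ℝ → ℝ} {p lam μ₁ μ₂ β γ : ℝ} {u v : ℝ → ℝ}

/-- A nonzero solution satisfying the stability inequality bounds `β + γ` from below. -/
theorem le_const_mul_add (hF : AssumptionF F p) (h : IsBoundedSolution N F μ₁ μ₂ β γ u v)
    {c₀ C₁ A : ℝ} (hN : 2 ≤ N) (hp : 2 < p) (hlam : 0 ≤ lam) (hμ₁ : 0 ≤ μ₁) (hμ₂ : 0 ≤ μ₂)
    (hβ : 0 < β) (hγ : 0 < γ) (hβγ : β + γ ≤ 1) (hc₀ : 0 < c₀) (hC₁ : 0 < C₁) (hA : 0 < A)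
    (hFc : ∀ z, c₀ * ‖z‖ ^ p ≤ F z)
    (hFC : ∀ z, |partialU F z| ≤ C₁ * ‖z‖ ^ (p - 1) ∧ |partialV F z| ≤ C₁ * ‖z‖ ^ (p - 1))
    (hcut : ∀ ε s δ : ℝ, 0 < ε → 0 < δ → 2 * δ ≤ s →
      ∃ θ : ℝ → ℝ, ContDiff ℝ 1 θ ∧ HasCompactSupport θ ∧ tsupport θ ⊆ Ioi 0 ∧
        tsupport θ ⊆ Icc (s - 2 / ε) (s + 2 / ε) ∧ (∀ t, 0 ≤ θ t ∧ θ t ≤ 1) ∧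
        (∀ t, s ≤ t → t ≤ s + 1 / ε → θ t = 1) ∧
        ∀ t, deriv θ t ^ 2 ≤ A * ε ^ 2 + (Icc δ (2 * δ)).indicator (fun _ => A / δ ^ 2) t)
    (hQ : ∀ φ : ℝ → EuclideanSpace ℝ (Fin 2), IsTestFunction φ →
      0 ≤ quadForm N F lam μ₁ μ₂ β γ u v φ)
    {t' : ℝ} (ht' : 0 ≤ t') (hne : (u t', v t') ≠ 0) :
    p * (p - 2) * c₀ * (1 / 4) ^ p * N / (8 * C₁) ≤ (9 + 16 * A + 8 * lam) * (β + γ) := by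
  have hN2 : (2 : ℝ) ≤ N := by exact_mod_cast hN
  set a : ℝ := N - γ with ha
  have ha1 : 1 ≤ a := by linarith
  obtain ⟨C, hC⟩ := h.bounded
  set r : ℝ → ℝ := fun t => ‖(u t, v t)‖ with hr
  have hbdd : BddAbove (r '' Ici 0) := by
    refine ⟨C, ?_⟩
    rintro _ ⟨t, ht, rfl⟩
    exact max_le (hC t ht).1 (hC t ht).2
  set M := sSup (r '' Ici 0) with hMdef
  have hrM : ∀ t, 0 ≤ t → r t ≤ M := fun t ht => le_csSup hbdd ⟨t, ht, rfl⟩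
  have hM : 0 < M := (norm_pos_iff.2 hne).trans_le (hrM t' ht')
  obtain ⟨_, ⟨t₀, ht₀, rfl⟩, hrt₀⟩ := exists_lt_of_lt_csSup (s := r '' Ici 0) (b := M / 2)
    ⟨_, t', ht', rfl⟩ (by rw [← hMdef]; linarith)
  set D := C₁ * M ^ (p - 1) with hD
  have hD0 : 0 < D := mul_pos hC₁ (Real.rpow_pos_of_pos hM _)
  set E := D / (N * a) with hE
  have hE0 : 0 < E := div_pos hD0 (mul_pos (by linarith) (by linarith))
  have hrpow : ∀ t, 0 ≤ t → C₁ * r t ^ (p - 1) ≤ D := fun t ht =>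
    mul_le_mul_of_nonneg_left
      (Real.rpow_le_rpow (norm_nonneg _) (hrM t ht) (by linarith)) hC₁.le
  have hinc : ∀ s t, 0 ≤ s → s ≤ t → r t ≤ r s + E * (Real.exp (-a * s) - Real.exp (-a * t)) :=
    fun s t hs hst => h.norm_le_norm_add hμ₁ hμ₂ hγ.le (by linarith)
      (fun t ht => ⟨(hFC _).1.trans (hrpow t ht), (hFC _).2.trans (hrpow t ht)⟩) hs hst
  have hr0 : r 0 = 0 := by simp [hr, h.zero_u, h.zero_v]
  obtain ⟨s₀, t₁, hs₀, hst, ht₁, hlow, hmass⟩ :=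
    exists_interval_of_increment ha1 hE0 hM hr0 ht₀ hrt₀.le hinc
  set ε := β + γ with hε
  have hε0 : 0 < ε := add_pos hβ hγ
  -- Since `1 - e^{-at} ≤ at`, the growth estimate from `0` gives `r t ≤ L t`.
  set L := E * a with hL
  have hL0 : 0 < L := mul_pos hE0 (by linarith)
  have hrL : ∀ t, 0 ≤ t → r t ≤ L * t := by
    intro t ht
    have h1 := hinc 0 t le_rfl ht
    rw [hr0, zero_add] at h1
    have h2 := Real.add_one_le_exp (-a * t)
    simp only [mul_zero, Real.exp_zero] at h1
    have h3 : E * (1 - Real.exp (-a * t)) ≤ E * (a * t) := by gcongr; linarith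
    rw [hL]; linarith
  have hsq : ∀ t, u t ^ 2 + v t ^ 2 ≤ 2 * r t ^ 2 := by
    intro t
    have h1 : |u t| ≤ r t := norm_fst_le (u t, v t)
    have h2 : |v t| ≤ r t := norm_snd_le (u t, v t)
    have h3 := sq_le_sq' (abs_le.1 h1).1 (abs_le.1 h1).2
    have h4 := sq_le_sq' (abs_le.1 h2).1 (abs_le.1 h2).2
    linarith
  -- `δ` makes the cost of cutting off near `0` at most `ε M²`; it may depend on the solution
  -- because it drops out of the final bound.
  obtain ⟨δ, hδ0, hδs, hδe⟩ : ∃ δ, 0 < δ ∧ 2 * δ ≤ s₀ ∧ 16 * A * L ^ 2 * δ ≤ ε * M ^ 2 := by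
    have hpos : 0 < 16 * A * L ^ 2 := by positivity
    refine ⟨min (s₀ / 2) (ε * M ^ 2 / (16 * A * L ^ 2)), ?_, ?_, ?_⟩
    · exact lt_min (by linarith) (by positivity)
    · linarith [min_le_left (s₀ / 2) (ε * M ^ 2 / (16 * A * L ^ 2))]
    · have := min_le_right (s₀ / 2) (ε * M ^ 2 / (16 * A * L ^ 2))
      rw [le_div_iff₀ hpos] at this
      linarith
  obtain ⟨θ, hθ, hθc, hθ0, hθs, hθ1, hθone, hθd⟩ := hcut ε s₀ δ hε0 hδ0 hδs
  set η : ℝ → ℝ := fun t => Real.exp (γ / 2 * t) * θ t with hη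
  have hηC : ContDiff ℝ 1 η := ContDiff.mul (by fun_prop) hθ
  have hηc : HasCompactSupport η := hθc.mul_left
  have hηs : tsupport η ⊆ Ioi 0 := tsupport_mul_subset_right.trans hθ0
  obtain ⟨hint, hstab⟩ := h.integral_potential_le hF hηC hηc hηs
    (hQ _ (h.isTestFunction_smul hηC hηc hηs))
  have hF0 : ∀ z, 0 ≤ F z := fun z =>
    (mul_nonneg hc₀.le (Real.rpow_nonneg (norm_nonneg _) _)).trans (hFc z)
  have hlower : c₀ * (M / 4) ^ p * ((Real.exp (-a * s₀) - Real.exp (-a * t₁)) / a)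
      ≤ ∫ t in Ioi (0 : ℝ), η t ^ 2 * (Real.exp (-N * t) * F (u t, v t)) := by
    have hsub : Ioc s₀ t₁ ⊆ Ioi 0 := fun t ht => hs₀.trans ht.1
    have hval : ∫ t in Ioc s₀ t₁, c₀ * (M / 4) ^ p * Real.exp (-a * t)
        = c₀ * (M / 4) ^ p * ((Real.exp (-a * s₀) - Real.exp (-a * t₁)) / a) := by
      rw [integral_const_mul, ← intervalIntegral.integral_of_le hst]
      congr 1
      have hd : ∀ t ∈ uIcc s₀ t₁,
          HasDerivAt (fun t => -Real.exp (-a * t) / a) (Real.exp (-a * t)) t := by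
        intro t _
        have h1 : HasDerivAt (fun t => Real.exp (-a * t)) (Real.exp (-a * t) * -a) t := by
          simpa using ((hasDerivAt_id t).const_mul (-a)).exp
        refine (h1.fun_neg.div_const a).congr_deriv ?_
        field_simp
      rw [intervalIntegral.integral_eq_sub_of_hasDerivAt hd
        ((by fun_prop : Continuous fun t => Real.exp (-a * t)).intervalIntegrable _ _)]
      ring
    rw [← hval]
    refine (setIntegral_mono_on ?_ (hint.mono_set hsub) measurableSet_Ioc ?_).trans
      (setIntegral_mono_set hint ?_ hsub.eventuallyLE)
    · exact (Continuous.integrableOn_Icc (by fun_prop)).mono_set Ioc_subset_Icc_self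
    · intro t ht
      have h1 : θ t = 1 := by
        refine hθone t ht.1.le (ht.2.trans (ht₁.trans ?_))
        have : 1 ≤ 1 / ε := by rw [le_div_iff₀ hε0]; linarith
        linarith
      have h2 : c₀ * (M / 4) ^ p ≤ F (u t, v t) :=
        (mul_le_mul_of_nonneg_left (Real.rpow_le_rpow (by positivity)
          (hlow t ⟨ht.1.le, ht.2⟩) (by linarith)) hc₀.le).trans (hFc _)
      -- The factor `e^{γt/2}` in `η` yields precisely the weight `e^{-at}` of the growth estimate,
      -- besides cancelling `e^{-γt}` on the right side.
      have h3 : η t ^ 2 * Real.exp (-N * t) = Real.exp (-a * t) := by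
        simp only [hη]
        rw [h1, mul_one, ← Real.exp_nat_mul, ← Real.exp_add, ha]
        congr 1
        push_cast; ring
      rw [← mul_assoc, h3, mul_comm]
      exact mul_le_mul_of_nonneg_left h2 (Real.exp_pos _).le
    · exact ae_of_all _ fun t => by
        have := hF0 (u t, v t)
        simp only [Pi.zero_apply]
        positivity
  have hupper : ∫ t in Ioi (0 : ℝ), Real.exp (-γ * t) * (deriv η t ^ 2 + lam * β ^ 2 * η t ^ 2)
        * (u t ^ 2 + v t ^ 2) ≤ 8 * M ^ 2 * ε * (1 + 2 * A + lam * β ^ 2 / ε ^ 2)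
          + 16 * A * L ^ 2 * δ := by
    have := integral_cutoff_le (u := u) (v := v) (θ := θ) (γ := γ) (M := M) (L := L)
      (b := lam * β ^ 2 / ε ^ 2) hγ.le (by linarith) hε0 hδ0 hA (by positivity)
      (hθ.differentiable one_ne_zero) hθs hθ1 hθd
      (fun t ht => (hsq t).trans (by gcongr; exact hrM t ht))
      (fun t ht => (hsq t).trans (by gcongr; exact hrL t ht))
    rwa [div_mul_cancel₀ _ (by positivity)] at this
  have hb : lam * β ^ 2 / ε ^ 2 ≤ lam := by
    rw [div_le_iff₀ (by positivity)]
    gcongr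
    linarith
  have hmass' : M / (8 * E * a) ≤ (Real.exp (-a * s₀) - Real.exp (-a * t₁)) / a := by
    rw [div_le_div_iff₀ (by positivity) (by linarith)]
    nlinarith
  have hpp : 0 ≤ p * (p - 2) := mul_nonneg (by linarith) (by linarith)
  have hkey : p * (p - 2) * (c₀ * (M / 4) ^ p * (M / (8 * E * a)))
      ≤ (9 + 16 * A + 8 * lam) * ε * M ^ 2 := by
    calc _ ≤ p * (p - 2) * (c₀ * (M / 4) ^ p
            * ((Real.exp (-a * s₀) - Real.exp (-a * t₁)) / a)) := by gcongr
      _ ≤ _ := mul_le_mul_of_nonneg_left hlower hpp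
      _ ≤ _ := hstab
      _ ≤ _ := hupper
      _ ≤ 8 * M ^ 2 * ε * (1 + 2 * A + lam) + ε * M ^ 2 := by gcongr
      _ = _ := by ring
  -- `E` carries a factor `M^{p-1}`, so the lower bound is a constant times `M²`, free of `a` as
  -- well.
  have hMp : (M / 4) ^ p * M = M ^ (p - 1) * (1 / 4) ^ p * M ^ 2 := by
    rw [div_eq_mul_one_div, Real.mul_rpow hM.le (by norm_num), Real.rpow_sub_one hM.ne']
    field_simp
  have heq : p * (p - 2) * (c₀ * (M / 4) ^ p * (M / (8 * E * a)))
      = p * (p - 2) * c₀ * (1 / 4) ^ p * N / (8 * C₁) * M ^ 2 := by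
    have hMp0 : M ^ (p - 1) ≠ 0 := (Real.rpow_pos_of_pos hM _).ne'
    have ha0 : a ≠ 0 := by linarith
    have hN0 : (N : ℝ) ≠ 0 := by linarith
    calc _ = p * (p - 2) * c₀ * ((M / 4) ^ p * M) / (8 * E * a) := by ring
      _ = _ := by rw [hMp, hE, hD]; field_simp
  rw [heq] at hkey
  exact le_of_mul_le_mul_right hkey (by positivity)

end IsBoundedSolution

end HenonSystem

theorem proposition3p1
    (N : ℕ) (hN : 2 ≤ N) (p : ℝ) (hp : 2 < p)
    (F : ℝ × ℝ → ℝ) (hF : HenonSystem.AssumptionF F p)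
    (lam μ₁ μ₂ : ℝ) (hlam : 0 ≤ lam) (hμ₁ : 0 ≤ μ₁) (hμ₂ : 0 ≤ μ₂)
    (β γ : ℕ → ℝ) (hβ : ∀ k, 0 < β k) (hγ : ∀ k, 0 < γ k)
    (hβ_lim : Tendsto β atTop (𝓝 0)) (hγ_lim : Tendsto γ atTop (𝓝 0))
    (u v : ℕ → ℝ → ℝ)
    (hsol : ∀ k, HenonSystem.IsBoundedSolution N F μ₁ μ₂ (β k) (γ k) (u k) (v k))
    (hQ : ∀ (k : ℕ) (φ : ℝ → EuclideanSpace ℝ (Fin 2)), HenonSystem.IsTestFunction φ →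
      0 ≤ HenonSystem.quadForm N F lam μ₁ μ₂ (β k) (γ k) (u k) (v k) φ) :
    ∀ᶠ k in atTop, ∀ t : ℝ, 0 ≤ t → u k t = 0 ∧ v k t = 0 := by
  obtain ⟨c₀, hc₀, hFc⟩ := HenonSystem.exists_le_of_homogeneous_pos hF.homogeneous
    hF.contDiff.continuous (by linarith) hF.pos
  obtain ⟨C₁, hC₁, hFU⟩ := HenonSystem.exists_abs_le_of_homogeneous
    (hF.homogeneous_fderiv (1, 0)) (hF.contDiff_fderiv_apply (1, 0)).continuous (by linarith)
  obtain ⟨C₂, hC₂, hFV⟩ := HenonSystem.exists_abs_le_of_homogeneous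
    (hF.homogeneous_fderiv (0, 1)) (hF.contDiff_fderiv_apply (0, 1)).continuous (by linarith)
  obtain ⟨A, hA, hcut⟩ := HenonSystem.exists_cutoff
  have hN0 : (0 : ℝ) < N := by exact_mod_cast (by omega : 0 < N)
  have hκ : 0 < p * (p - 2) * c₀ * (1 / 4) ^ p * N / (8 * max C₁ C₂) := by
    have h1 : 0 < p := by linarith
    have h2 : 0 < p - 2 := by linarith
    positivity
  have hlim : Tendsto (fun k => (9 + 16 * A + 8 * lam) * (β k + γ k)) atTop (𝓝 0) := by
    simpa using (hβ_lim.add hγ_lim).const_mul (9 + 16 * A + 8 * lam)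
  filter_upwards [hlim.eventually (gt_mem_nhds hκ), hlim.eventually (gt_mem_nhds one_pos)]
    with k hk hk1 t ht
  by_contra hne
  -- The coefficient `9 + 16A + 8λ` exceeds `1`, so a product below `1` forces the sum below `1`.
  have hβγ : β k + γ k ≤ 1 := by nlinarith [hβ k, hγ k]
  refine absurd hk (not_lt.2 ((hsol k).le_const_mul_add hF hN hp hlam hμ₁ hμ₂ (hβ k) (hγ k) hβγ
    hc₀ (lt_max_of_lt_left hC₁) hA hFc (fun z => ⟨(hFU z).trans ?_, (hFV z).trans ?_⟩) hcut
    (hQ k) ht fun h0 => hne (Prod.mk_eq_zero.1 h0)))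
  · gcongr; exact le_max_left _ _
  · gcongr; exact le_max_right _ _
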